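/- Let $(\xi_i)_{i\ge 0}$ be independent standard Gaussian random variables on a probability space, and let $\mathcal X_2^*$ be the set of random variables $$q=c+\sum_{i\ge 0}\alpha_i\xi_i+\sum_{i\ge 0}\beta_i(\xi_i^2-1),\qquad c\in\mathbb R,\ (\alpha_i)_i,(\beta_i)_i\in\ell^2(\mathbb N),$$ the series converging in $L^2$. 1. For every $c_0>0$ there is a constant $C(c_0)>0$, depending only on $c_0$, such that for all $\varepsilon\ge 0$ $$\sup\{P(|q|\le\varepsilon): q\in\mathcal X_2^*,\ |\mathbb E[q]|\ge c_0\}\le C(c_0)\,\varepsilon^{2/7}.$$ 2. For every $c_0>0$ there is a constant $C'(c_0)>0$, depending only on $c_0$, such that for all $\varepsilon\ge 0$ $$\sup\{P(|q|\le\varepsilon): q\in\mathcal X_2^*,\ \mathbb E[q^2]\ge c_0\}\le C'(c_0)\,\varepsilon^{1/3}.$$ 3. For every $q\in\mathcal X_2^*$ as above with $\max_i|\beta_i|>0$ and every $\varepsilon\ge 0$, $$P(|q|\le\varepsilon)\le 2\sqrt{\frac{1}{\pi}\,\frac{\varepsilon}{\max_i|\beta_i|}}.$$ -/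

import Mathlib

open MeasureTheory ProbabilityTheory Filter Topology

/-- `ξ` is a sequence of independent standard Gaussian random variables on `(Ω, μ)`. -/
structure IsStdGaussianSeq {Ω : Type*} [MeasurableSpace Ω] (μ : Measure Ω) (ξ : ℕ → Ω → ℝ) :
    Prop where
  indep : iIndepFun ξ μ
  law : ∀ i, HasLaw (ξ i) (gaussianReal 0 1) μ

/-- The partial sums of the series `c + ∑ α_i ξ_i + ∑ β_i (ξ_i² - 1)`. -/
noncomputable def quadPartialSum {Ω : Type*} (ξ : ℕ → Ω → ℝ) (c : ℝ) (α β : ℕ → ℝ) (n : ℕ)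
    (ω : Ω) : ℝ :=
  c + ∑ i ∈ Finset.range n, (α i * ξ i ω + β i * ((ξ i ω) ^ 2 - 1))

/-- The random variable `q` is the sum `c + ∑ α_i ξ_i + ∑ β_i (ξ_i² - 1)`, with coefficient
sequences in `ℓ²`; the series converges in `L²(μ)`. -/
structure HasQuadExpansion {Ω : Type*} [MeasurableSpace Ω] (μ : Measure Ω) (ξ : ℕ → Ω → ℝ)
    (c : ℝ) (α β : ℕ → ℝ) (q : Ω → ℝ) : Prop where
  memℓp_lin : Memℓp α 2
  memℓp_quad : Memℓp β 2
  memLp : MemLp q 2 μ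
  tendsto : Tendsto (fun n => eLpNorm (fun ω => quadPartialSum ξ c α β n ω - q ω) 2 μ)
    atTop (𝓝 0)

/-- The set of all random variables of the form `c + ∑ α_i ξ_i + ∑ β_i (ξ_i² - 1)`. -/
def quadForms {Ω : Type*} [MeasurableSpace Ω] (μ : Measure Ω) (ξ : ℕ → Ω → ℝ) : Set (Ω → ℝ) :=
  {q | ∃ (c : ℝ) (α β : ℕ → ℝ), HasQuadExpansion μ ξ c α β q}

/-- `max_i |β_i|`; for `β` in `ℓ²` the supremum is attained. -/
noncomputable def maxAbs (β : ℕ → ℝ) : ℝ := ⨆ i, |β i|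

theorem one_add_sum_le_prod_one_add {ι : Type*} (s : Finset ι) (f : ι → ℝ) (hf : ∀ i, 0 ≤ f i) :
    1 + ∑ i ∈ s, f i ≤ ∏ i ∈ s, (1 + f i) := by
  classical
  induction s using Finset.induction_on with
  | empty => simp
  | insert a s ha ih =>
    rw [Finset.sum_insert ha, Finset.prod_insert ha]
    nlinarith [hf a, Finset.sum_nonneg (s := s) fun i _ => hf i, mul_nonneg (hf a)
      (Finset.sum_nonneg (s := s) fun i _ => hf i)]

theorem integral_cexp_quad_gaussianReal (a b t : ℝ) :
    ∫ x, Complex.exp (t * ((a * x + b * (x ^ 2 - 1) : ℝ) : ℂ) * Complex.I) ∂gaussianReal 0 1 =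
      ((√(2 * Real.pi))⁻¹ : ℝ) *
        ((Real.pi / -(-(1 / 2) + t * b * Complex.I : ℂ)) ^ (1 / 2 : ℂ) *
        Complex.exp (-(t * b * Complex.I) -
          (t * a * Complex.I) ^ 2 / (4 * (-(1 / 2) + t * b * Complex.I)))) := by
  rw [integral_gaussianReal_eq_integral_smul one_ne_zero,
    ← integral_cexp_quadratic (by simp), ← integral_const_mul]
  congr with x
  rw [gaussianPDFReal, Complex.real_smul, Complex.ofReal_mul, mul_assoc, Complex.ofReal_exp,
    ← Complex.exp_add]
  congr 1
  · simp
  · congr 1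
    push_cast
    ring

theorem norm_integral_cexp_quad_gaussianReal_pow_mul_le (a b t : ℝ) :
    ‖∫ x, Complex.exp (t * ((a * x + b * (x ^ 2 - 1) : ℝ) : ℂ) * Complex.I)
      ∂gaussianReal 0 1‖ ^ 4 * (1 + 2 * t ^ 2 * (a ^ 2 + 2 * b ^ 2)) ≤ 1 := by
  rw [integral_cexp_quad_gaussianReal]
  set w : ℂ := -(1 / 2) + t * b * Complex.I with hw
  have hre : w.re = -(1 / 2) := by simp [hw]
  have him : w.im = t * b := by simp [hw]
  have hw0 : w ≠ 0 := by
    intro h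
    rw [h] at hre
    norm_num at hre
  have hn : ‖w‖ ^ 2 = 1 / 4 * (1 + 4 * t ^ 2 * b ^ 2) := by
    rw [Complex.sq_norm, Complex.normSq_apply, hre, him]; ring
  have hwp : 0 < ‖w‖ := norm_pos_iff.2 hw0
  have h1 : ‖(Real.pi / -w : ℂ) ^ (1 / 2 : ℂ)‖ = (Real.pi / ‖w‖) ^ (1 / 2 : ℝ) := by
    have := Complex.norm_cpow_real (Real.pi / -w : ℂ) (1 / 2)
    push_cast at this
    rw [this]
    simp [abs_of_pos Real.pi_pos]
  have h2 : ‖Complex.exp (-(t * b * Complex.I) - (t * a * Complex.I) ^ 2 / (4 * w))‖ =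
      Real.exp (-(t ^ 2 * a ^ 2 / 2 / (1 + 4 * t ^ 2 * b ^ 2))) := by
    rw [Complex.norm_exp]
    congr 1
    have : (t * a * Complex.I : ℂ) ^ 2 / (4 * w) = ((-(t ^ 2 * a ^ 2 / 4) : ℝ) : ℂ) * w⁻¹ := by
      rw [mul_pow, Complex.I_sq]
      push_cast
      field_simp
    rw [Complex.sub_re, this, Complex.re_ofReal_mul, Complex.inv_re, hre, ← Complex.sq_norm, hn]
    simp
    field_simp
  set D : ℝ := 1 + 4 * t ^ 2 * b ^ 2 with hD
  have hDp : 0 < D := by positivity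
  rw [norm_mul, norm_mul, h1, h2, mul_pow, mul_pow, Complex.norm_real, Real.norm_eq_abs,
    abs_of_nonneg (by positivity), ← Real.exp_nat_mul]
  have e1 : (√(2 * Real.pi))⁻¹ ^ 4 = 1 / (4 * Real.pi ^ 2) := by
    rw [show (√(2 * Real.pi))⁻¹ ^ 4 = ((√(2 * Real.pi)) ^ 2 * (√(2 * Real.pi)) ^ 2)⁻¹ by
      rw [inv_pow]; ring, Real.sq_sqrt (by positivity)]
    field_simp
    ring
  have e2 : ((Real.pi / ‖w‖) ^ (1 / 2 : ℝ)) ^ 4 = Real.pi ^ 2 / (D / 4) := by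
    rw [← Real.rpow_natCast, ← Real.rpow_mul (by positivity)]
    norm_num
    rw [div_pow, hn]
    congr 1
    ring
  rw [e1, e2]
  have e3 : 1 + 2 * t ^ 2 * (a ^ 2 + 2 * b ^ 2) ≤
      D * Real.exp (2 * (t ^ 2 * a ^ 2) / D) := by
    have := Real.add_one_le_exp (2 * (t ^ 2 * a ^ 2) / D)
    calc _ = D * (2 * (t ^ 2 * a ^ 2) / D + 1) := by field_simp; rw [hD]; ring
      _ ≤ _ := by gcongr
  calc _ ≤ 1 / (4 * Real.pi ^ 2) * (Real.pi ^ 2 / (D / 4) *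
        Real.exp ((4 : ℕ) * -(t ^ 2 * a ^ 2 / 2 / D))) *
          (D * Real.exp (2 * (t ^ 2 * a ^ 2) / D)) := by gcongr
    _ = Real.exp ((4 : ℕ) * -(t ^ 2 * a ^ 2 / 2 / D) + 2 * (t ^ 2 * a ^ 2) / D) := by
      rw [Real.exp_add]
      field_simp [Real.pi_ne_zero]
    _ = 1 := by
      rw [Real.exp_eq_one_iff]
      push_cast
      ring

theorem integrable_abs_rpow_neg_half_gaussianReal :
    Integrable (fun z : ℝ => |z| ^ (-(1 / 2) : ℝ)) (gaussianReal 0 1) := by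
  have h := integrable_rpow_mul_exp_neg_mul_sq (b := 1 / 2) (by norm_num)
    (s := -(1 / 2)) (by norm_num)
  have h' := h.comp_neg
  have hs := ((h.norm.add h'.norm).const_mul (√(2 * Real.pi))⁻¹)
  rw [gaussianReal_of_var_ne_zero _ one_ne_zero,
    integrable_withDensity_iff (measurable_gaussianPDF _ _) (ae_of_all _ fun _ => gaussianPDF_lt_top)]
  refine hs.mono' (by fun_prop) (ae_of_all _ fun x => ?_)
  rw [toReal_gaussianPDF, gaussianPDFReal]
  simp only [Pi.add_apply, norm_mul, Real.norm_eq_abs, NNReal.coe_one, mul_one, sub_zero,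
    Real.abs_exp, even_two.neg_pow]
  have h3 : |(|x| ^ (-(1 / 2) : ℝ))| ≤ |x ^ (-(1 / 2) : ℝ)| + |(-x) ^ (-(1 / 2) : ℝ)| := by
    rcases abs_choice x with h | h <;> rw [h] <;> simp
  rw [abs_of_nonneg (a := (√(2 * Real.pi))⁻¹) (by positivity), mul_left_comm, ← add_mul,
    show -x ^ 2 / 2 = -(1 / 2) * x ^ 2 by ring]
  gcongr

/-- Smoothing inequality: the concentration of a law at scale `ε` is controlled by its
characteristic function. -/
theorem measureReal_abs_le_le_integral_norm_charFun (ν : Measure ℝ) [IsProbabilityMeasure ν]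
    {ε : ℝ} (hε : 0 < ε) :
    ν.real {x | |x| ≤ ε} ≤ Real.exp (1 / 2) * ∫ z, ‖charFun ν (z / ε)‖ ∂gaussianReal 0 1 := by
  have hG : ∀ x : ℝ, charFun (gaussianReal 0 1) (x / ε) =
      ((Real.exp (-(x / ε) ^ 2 / 2) : ℝ) : ℂ) := fun x => by
    rw [charFun_gaussianReal]
    push_cast
    congr 1
    simp
    ring
  have hI : Integrable (fun x : ℝ => Real.exp (-(x / ε) ^ 2 / 2)) ν := by
    refine Integrable.of_bound (by fun_prop) 1 (ae_of_all _ fun x => ?_)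
    rw [Real.norm_eq_abs, Real.abs_exp, Real.exp_le_one_iff]
    nlinarith [sq_nonneg (x / ε)]
  have h1 : ν.real {x | |x| ≤ ε} ≤ ∫ x, Real.exp (1 / 2) * Real.exp (-(x / ε) ^ 2 / 2) ∂ν := by
    rw [← integral_indicator_one (measurableSet_le (by fun_prop) (by fun_prop))]
    refine integral_mono_of_nonneg (ae_of_all _ fun x => Set.indicator_nonneg (by simp) x)
      (hI.const_mul _) (ae_of_all _ fun x => ?_)
    refine Set.indicator_apply_le' (fun hx => ?_) fun _ => by positivity
    beta_reduce
    rw [← Real.exp_add, Pi.one_apply, Real.one_le_exp_iff]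
    have : (x / ε) ^ 2 ≤ 1 := by
      rw [sq_le_one_iff_abs_le_one, abs_div, abs_of_pos hε]
      exact (div_le_one hε).2 hx
    linarith
  have h2 : ((∫ x, Real.exp (-(x / ε) ^ 2 / 2) ∂ν : ℝ) : ℂ) =
      ∫ z, charFun ν (z / ε) ∂gaussianReal 0 1 := by
    rw [← integral_complex_ofReal]
    simp_rw [← hG, charFun_apply_real]
    rw [integral_integral_swap]
    · congr with z
      congr with x
      push_cast
      congr 2
      ring
    · refine Integrable.of_bound (by fun_prop) 1 (ae_of_all _ fun p => ?_)
      simp only [Function.uncurry]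
      rw [← Complex.ofReal_mul, Complex.norm_exp_ofReal_mul_I]
  rw [integral_const_mul] at h1
  refine h1.trans ?_
  gcongr
  calc _ ≤ ‖((∫ x, Real.exp (-(x / ε) ^ 2 / 2) ∂ν : ℝ) : ℂ)‖ := by
        rw [Complex.norm_real]; exact le_abs_self _
    _ ≤ _ := by rw [h2]; exact norm_integral_le_integral_norm _

/-- The constant in the bound `measureReal_abs_le_le_of_norm_charFun`. -/
noncomputable def smoothingConst : ℝ :=
  Real.exp (1 / 2) * ∫ z : ℝ, |z| ^ (-(1 / 2) : ℝ) ∂gaussianReal 0 1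

theorem smoothingConst_nonneg : 0 ≤ smoothingConst :=
  mul_nonneg (Real.exp_pos _).le (integral_nonneg fun _ => by positivity)

theorem measureReal_abs_le_le_of_norm_charFun (ν : Measure ℝ) [IsProbabilityMeasure ν] {s : ℝ}
    (hs : 0 < s) (h : ∀ t, ‖charFun ν t‖ ^ 4 * (1 + 2 * t ^ 2 * s ^ 2) ≤ 1) {ε : ℝ} (hε : 0 < ε) :
    ν.real {x | |x| ≤ ε} ≤ smoothingConst * (ε / s) ^ (1 / 2 : ℝ) := by
  refine (measureReal_abs_le_le_integral_norm_charFun ν hε).trans ?_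
  rw [smoothingConst, mul_assoc, ← integral_mul_const]
  refine mul_le_mul_of_nonneg_left ?_ (Real.exp_pos _).le
  refine integral_mono_of_nonneg (ae_of_all _ fun z => norm_nonneg (charFun ν (z / ε)))
    (integrable_abs_rpow_neg_half_gaussianReal.mul_const _) ?_
  have hz : ∀ᵐ z : ℝ ∂gaussianReal 0 1, z ≠ 0 :=
    (gaussianReal_absolutelyContinuous 0 one_ne_zero).ae_le (Measure.ae_ne volume 0)
  filter_upwards [hz] with z hz
  have hz' : 0 < |z| := abs_pos.2 hz
  refine le_of_pow_le_pow_left₀ (n := 4) (by norm_num) (by positivity) ?_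
  have e : (|z| ^ (-(1 / 2) : ℝ) * (ε / s) ^ (1 / 2 : ℝ)) ^ 4 = ε ^ 2 / (z ^ 2 * s ^ 2) := by
    rw [mul_pow, ← Real.rpow_natCast, ← Real.rpow_natCast, ← Real.rpow_mul (by positivity),
      ← Real.rpow_mul (by positivity)]
    norm_num
    field_simp
  rw [e, le_div_iff₀ (by positivity)]
  have h4 := h (z / ε)
  have h5 : z ^ 2 * s ^ 2 ≤ ε ^ 2 * (1 + 2 * (z / ε) ^ 2 * s ^ 2) := by
    have : ε ^ 2 * (1 + 2 * (z / ε) ^ 2 * s ^ 2) = ε ^ 2 + 2 * (z ^ 2 * s ^ 2) := by field_simp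
    rw [this]
    nlinarith [sq_nonneg ε, mul_nonneg (sq_nonneg z) (sq_nonneg s)]
  calc _ ≤ ‖charFun ν (z / ε)‖ ^ 4 * (ε ^ 2 * (1 + 2 * (z / ε) ^ 2 * s ^ 2)) := by gcongr
    _ = ε ^ 2 * (‖charFun ν (z / ε)‖ ^ 4 * (1 + 2 * (z / ε) ^ 2 * s ^ 2)) := by ring
    _ ≤ _ := mul_le_of_le_one_right (sq_nonneg _) h4

section

variable {Ω : Type*} [MeasurableSpace Ω] {μ : Measure Ω} {ξ : ℕ → Ω → ℝ}

theorem norm_charFun_quadPartialSum_le (hξ : IsStdGaussianSeq μ ξ) (c : ℝ) (α β : ℕ → ℝ) (n : ℕ)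
    (t : ℝ) : ‖charFun (μ.map (quadPartialSum ξ c α β n)) t‖ ^ 4 *
      (1 + 2 * t ^ 2 * ∑ i ∈ Finset.range n, (α i ^ 2 + 2 * β i ^ 2)) ≤ 1 := by
  have hm : ∀ i, AEMeasurable (ξ i) μ := fun i => (hξ.law i).aemeasurable
  have hterm : ∀ i, Measurable fun x : ℝ => α i * x + β i * (x ^ 2 - 1) := fun i => by fun_prop
  have hX : ∀ i, AEMeasurable (fun ω => α i * ξ i ω + β i * (ξ i ω ^ 2 - 1)) μ := fun i =>
    (hterm i).comp_aemeasurable (hm i)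
  have hind : iIndepFun (fun i ω => α i * ξ i ω + β i * (ξ i ω ^ 2 - 1)) μ :=
    hξ.indep.comp _ hterm
  have h1 : μ.map (quadPartialSum ξ c α β n) = (μ.map fun ω => ∑ i ∈ Finset.range n,
      (α i * ξ i ω + β i * (ξ i ω ^ 2 - 1))).map (c + ·) := by
    rw [AEMeasurable.map_map_of_aemeasurable (by fun_prop)
      (Finset.aemeasurable_fun_sum _ fun i _ => hX i)]
    rfl
  have h2 : ‖charFun (μ.map (quadPartialSum ξ c α β n)) t‖ = ∏ i ∈ Finset.range n,
      ‖charFun (μ.map fun ω => α i * ξ i ω + β i * (ξ i ω ^ 2 - 1)) t‖ := by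
    rw [h1, charFun_map_const_add, norm_mul,
      iIndepFun.charFun_map_fun_finsetSum_eq_prod (fun i _ => hX i) (hind.restrict _),
      Finset.prod_apply, norm_prod]
    simp [Complex.norm_exp]
  have h3 : ∀ i, charFun (μ.map fun ω => α i * ξ i ω + β i * (ξ i ω ^ 2 - 1)) t =
      ∫ x, Complex.exp (t * ((α i * x + β i * (x ^ 2 - 1) : ℝ) : ℂ) * Complex.I)
        ∂gaussianReal 0 1 := fun i => by
    rw [charFun_apply_real, integral_map (hX i) (by fun_prop)]
    exact (hξ.law i).integral_comp
      (f := fun x : ℝ => Complex.exp (t * ((α i * x + β i * (x ^ 2 - 1) : ℝ) : ℂ) * Complex.I))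
      (by fun_prop)
  rw [h2, ← Finset.prod_pow, Finset.mul_sum]
  refine (mul_le_mul_of_nonneg_left (one_add_sum_le_prod_one_add _ _ fun i => by positivity)
    (by positivity)).trans ?_
  rw [← Finset.prod_mul_distrib]
  refine Finset.prod_le_one (fun i _ => by positivity) fun i _ => ?_
  rw [h3]
  exact norm_integral_cexp_quad_gaussianReal_pow_mul_le _ _ _

theorem aemeasurable_quadPartialSum (hξ : IsStdGaussianSeq μ ξ) (c : ℝ) (α β : ℕ → ℝ) (n : ℕ) :
    AEMeasurable (quadPartialSum ξ c α β n) μ := by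
  have hm : ∀ i, AEMeasurable (ξ i) μ := fun i => (hξ.law i).aemeasurable
  unfold quadPartialSum
  fun_prop

theorem measureReal_abs_quadPartialSum_le [IsProbabilityMeasure μ] (hξ : IsStdGaussianSeq μ ξ)
    (c : ℝ) (α β : ℕ → ℝ) (n : ℕ) {s : ℝ} (hs : 0 < s)
    (hs2 : s ^ 2 = ∑ i ∈ Finset.range n, (α i ^ 2 + 2 * β i ^ 2)) {ε : ℝ} (hε : 0 < ε) :
    μ.real {ω | |quadPartialSum ξ c α β n ω| ≤ ε} ≤
      smoothingConst * (ε / s) ^ (1 / 2 : ℝ) := by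
  have hq := aemeasurable_quadPartialSum hξ c α β n
  have := Measure.isProbabilityMeasure_map hq
  have h := measureReal_abs_le_le_of_norm_charFun (μ.map (quadPartialSum ξ c α β n)) hs
    (fun t => hs2 ▸ norm_charFun_quadPartialSum_le hξ c α β n t) hε
  rwa [map_measureReal_apply_of_aemeasurable hq
    (measurableSet_le (by fun_prop) (by fun_prop))] at h

end

theorem volume_abs_sq_sub_le_le (p r δ : ℝ) :
    volume {x : ℝ | |(x + p) ^ 2 - r| ≤ δ} ≤ ENNReal.ofReal (2 * √(2 * δ)) := by
  rcases lt_or_ge δ 0 with hδ | hδ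
  · have : {x : ℝ | |(x + p) ^ 2 - r| ≤ δ} = ∅ :=
      Set.eq_empty_of_forall_notMem fun x hx => by
        have hx' : |(x + p) ^ 2 - r| ≤ δ := hx
        linarith [abs_nonneg ((x + p) ^ 2 - r)]
    simp [this]
  have hu : √(r + δ) - √(r - δ) ≤ √(2 * δ) := by
    rw [sub_le_iff_le_add, Real.sqrt_le_left (by positivity)]
    rcases le_total 0 (r - δ) with h | h
    · nlinarith [Real.sq_sqrt h, Real.sq_sqrt (x := 2 * δ) (by positivity),
        Real.sqrt_nonneg (2 * δ), Real.sqrt_nonneg (r - δ),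
        mul_nonneg (Real.sqrt_nonneg (2 * δ)) (Real.sqrt_nonneg (r - δ))]
    · rw [Real.sqrt_eq_zero_of_nonpos h, add_zero, Real.sq_sqrt (by positivity)]
      linarith
  have hsub : {x : ℝ | |(x + p) ^ 2 - r| ≤ δ} ⊆
      Set.Icc (-p + √(r - δ)) (-p + √(r + δ)) ∪ Set.Icc (-p - √(r + δ)) (-p - √(r - δ)) := by
    intro x hx
    have hx' : |(x + p) ^ 2 - r| ≤ δ := hx
    obtain ⟨h1, h2⟩ := abs_le.1 hx'
    have h3 : |x + p| ≤ √(r + δ) := Real.abs_le_sqrt (by linarith)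
    have h4 : √(r - δ) ≤ |x + p| := Real.sqrt_le_iff.2 ⟨abs_nonneg _, by rw [sq_abs]; linarith⟩
    rcases abs_cases (x + p) with ⟨h, -⟩ | ⟨h, -⟩ <;> rw [h] at h3 h4
    · left; constructor <;> linarith
    · right; constructor <;> linarith
  calc _ ≤ _ := measure_mono hsub
    _ ≤ _ := measure_union_le _ _
    _ ≤ ENNReal.ofReal (√(2 * δ)) + ENNReal.ofReal (√(2 * δ)) := by
      rw [Real.volume_Icc, Real.volume_Icc]
      gcongr <;> linarith
    _ = _ := by rw [← ENNReal.ofReal_add (by positivity) (by positivity)]; congr 1; ring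

theorem gaussianReal_abs_quadratic_le_le {b : ℝ} (hb : b ≠ 0) (a r ε : ℝ) :
    gaussianReal 0 1 {x | |a * x + b * (x ^ 2 - 1) + r| ≤ ε} ≤
      ENNReal.ofReal (2 * √((1 / Real.pi) * (ε / |b|))) := by
  have hb' : 0 < |b| := abs_pos.2 hb
  have hset : {x : ℝ | |a * x + b * (x ^ 2 - 1) + r| ≤ ε} =
      {x | |(x + a / (2 * b)) ^ 2 - ((a / (2 * b)) ^ 2 + 1 - r / b)| ≤ ε / |b|} := by
    ext x
    rw [Set.mem_ofPred_eq, Set.mem_ofPred_eq, le_div_iff₀ hb', ← abs_mul]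
    congr! 2
    field_simp
    ring
  have hpdf : ∀ x, gaussianPDF 0 1 x ≤ ENNReal.ofReal (√(2 * Real.pi))⁻¹ := fun x => by
    refine ENNReal.ofReal_le_ofReal ?_
    simp only [gaussianPDFReal, NNReal.coe_one, mul_one]
    refine mul_le_of_le_one_right (by positivity) (Real.exp_le_one_iff.2 ?_)
    nlinarith [sq_nonneg (x - 0)]
  rw [hset, gaussianReal_apply _ one_ne_zero]
  calc _ ≤ ∫⁻ x in {x | |(x + a / (2 * b)) ^ 2 - ((a / (2 * b)) ^ 2 + 1 - r / b)| ≤ ε / |b|},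
        ENNReal.ofReal (√(2 * Real.pi))⁻¹ := lintegral_mono hpdf
    _ ≤ ENNReal.ofReal (√(2 * Real.pi))⁻¹ * ENNReal.ofReal (2 * √(2 * (ε / |b|))) := by
      rw [setLIntegral_const]
      gcongr
      exact volume_abs_sq_sub_le_le _ _ _
    _ = _ := by
      rw [← ENNReal.ofReal_mul (by positivity)]
      congr 1
      rw [Real.sqrt_mul (by positivity), Real.sqrt_mul (by positivity) (ε / |b|),
        Real.sqrt_mul (by positivity), Real.sqrt_div zero_le_one, Real.sqrt_one]
      have := Real.sqrt_pos.2 Real.pi_pos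
      field_simp

section

variable {Ω : Type*} [MeasurableSpace Ω] {μ : Measure Ω} {ξ : ℕ → Ω → ℝ}

theorem measureReal_abs_quadPartialSum_le_of_mem [IsProbabilityMeasure μ]
    (hξ : IsStdGaussianSeq μ ξ) (c : ℝ) (α β : ℕ → ℝ) {n k : ℕ} (hk : k < n) (hβ : β k ≠ 0)
    (ε : ℝ) : μ.real {ω | |quadPartialSum ξ c α β n ω| ≤ ε} ≤
      2 * √((1 / Real.pi) * (ε / |β k|)) := by
  have hm : ∀ i, AEMeasurable (ξ i) μ := fun i => (hξ.law i).aemeasurable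
  set T := (Finset.range n).erase k with hT
  set R : Ω → ℝ := fun ω => c + ∑ i ∈ T, (α i * ξ i ω + β i * (ξ i ω ^ 2 - 1)) with hR
  have hRm : AEMeasurable R μ := by fun_prop
  have hind : IndepFun (ξ k) R μ := by
    have h := hξ.indep.indepFun_finset₀ {k} T (by simp [hT]) hm
    have hφ : Measurable fun x : ({k} : Finset ℕ) → ℝ => x ⟨k, by simp⟩ := measurable_pi_apply _
    have h' := h.comp hφ
      (ψ := fun x : T → ℝ => c + ∑ i : T, (α i * x i + β i * (x i ^ 2 - 1)))
      (by fun_prop)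
    have hRe : R = (fun x : T → ℝ => c + ∑ i : T, (α i * x i + β i * (x i ^ 2 - 1))) ∘
        fun ω i => ξ i ω := by
      funext ω
      simp only [hR, Function.comp]
      rw [← Finset.sum_coe_sort T]
    rw [hRe]
    exact h'
  have hq : ∀ ω, quadPartialSum ξ c α β n ω = α k * ξ k ω + β k * (ξ k ω ^ 2 - 1) + R ω :=
    fun ω => by
      rw [quadPartialSum, ← Finset.add_sum_erase _ _ (Finset.mem_range.2 hk)]
      ring
  have hS : MeasurableSet {p : ℝ × ℝ | |α k * p.1 + β k * (p.1 ^ 2 - 1) + p.2| ≤ ε} :=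
    measurableSet_le (by fun_prop) (by fun_prop)
  have h1 : μ {ω | |quadPartialSum ξ c α β n ω| ≤ ε} =
      (μ.map fun ω => (ξ k ω, R ω)) {p | |α k * p.1 + β k * (p.1 ^ 2 - 1) + p.2| ≤ ε} := by
    rw [Measure.map_apply_of_aemeasurable ((hm k).prodMk hRm) hS]
    simp only [hq]
    rfl
  have := Measure.isProbabilityMeasure_map hRm
  rw [(indepFun_iff_map_prod_eq_prod_map_map (hm k) hRm).1 hind, (hξ.law k).map_eq,
    Measure.prod_apply_symm hS] at h1
  refine ENNReal.toReal_le_of_le_ofReal (by positivity) ?_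
  rw [h1]
  calc _ ≤ ∫⁻ _, ENNReal.ofReal (2 * √((1 / Real.pi) * (ε / |β k|))) ∂μ.map R :=
        lintegral_mono fun r => gaussianReal_abs_quadratic_le_le hβ _ _ _
    _ = _ := by simp

theorem HasQuadExpansion.tendstoInMeasure [IsProbabilityMeasure μ] (hξ : IsStdGaussianSeq μ ξ)
    {c : ℝ} {α β : ℕ → ℝ} {q : Ω → ℝ} (h : HasQuadExpansion μ ξ c α β q) :
    TendstoInMeasure μ (quadPartialSum ξ c α β) atTop q :=
  tendstoInMeasure_of_tendsto_eLpNorm (p := 2) (by simp)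
    (fun n => (aemeasurable_quadPartialSum hξ c α β n).aestronglyMeasurable)
    h.memLp.aestronglyMeasurable h.tendsto

/-- A continuous concentration bound is stable under limits in measure. -/
theorem measureReal_abs_le_le_of_tendstoInMeasure [IsProbabilityMeasure μ] {f : ℕ → Ω → ℝ}
    {q : Ω → ℝ} (hf : TendstoInMeasure μ f atTop q) {F : ℝ → ℝ} (hF : Continuous F)
    (h : ∀ᶠ n in atTop, ∀ ε, 0 < ε → μ.real {ω | |f n ω| ≤ ε} ≤ F ε) {ε : ℝ} (hε : 0 ≤ ε) :
    μ.real {ω | |q ω| ≤ ε} ≤ F ε := by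
  rw [tendstoInMeasure_iff_measureReal_norm] at hf
  have h1 : ∀ δ, 0 < δ → μ.real {ω | |q ω| ≤ ε} ≤ F (ε + δ) := fun δ hδ => by
    have hl := (hf δ hδ).const_add (F (ε + δ))
    rw [add_zero] at hl
    refine ge_of_tendsto hl ?_
    filter_upwards [h] with n hn
    refine le_trans ?_ (add_le_add_left (hn (ε + δ) (by positivity)) _)
    refine (measureReal_mono fun ω hω => ?_).trans (measureReal_union_le _ _)
    rw [Set.mem_union, or_iff_not_imp_right]
    intro h'
    simp only [Set.mem_ofPred_eq, not_le, Real.norm_eq_abs] at h' hω ⊢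
    have := abs_sub_abs_le_abs_sub (f n ω) (q ω)
    linarith
  have h2 : Tendsto (fun δ => F (ε + δ)) (𝓝[>] 0) (𝓝 (F ε)) := by
    have : Tendsto (fun δ => F (ε + δ)) (𝓝 0) (𝓝 (F (ε + 0))) :=
      Continuous.tendsto (by fun_prop) 0
    rw [add_zero] at this
    exact this.mono_left nhdsWithin_le_nhds
  exact ge_of_tendsto h2 (eventually_mem_nhdsWithin.mono fun δ hδ => h1 δ hδ)

theorem HasQuadExpansion.measureReal_abs_le_le_sqrt [IsProbabilityMeasure μ]
    (hξ : IsStdGaussianSeq μ ξ) {c : ℝ} {α β : ℕ → ℝ} {q : Ω → ℝ}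
    (h : HasQuadExpansion μ ξ c α β q) (hβ : 0 < maxAbs β) {ε : ℝ} (hε : 0 ≤ ε) :
    μ.real {ω | |q ω| ≤ ε} ≤ 2 * √((1 / Real.pi) * (ε / maxAbs β)) := by
  have h1 : ∀ m ∈ Set.Ioo 0 (maxAbs β),
      μ.real {ω | |q ω| ≤ ε} ≤ 2 * √((1 / Real.pi) * (ε / m)) := by
    rintro m ⟨hm0, hm⟩
    obtain ⟨k, hk⟩ := exists_lt_of_lt_ciSup hm
    refine measureReal_abs_le_le_of_tendstoInMeasure (h.tendstoInMeasure hξ)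
      (F := fun ε => 2 * √((1 / Real.pi) * (ε / m))) (by fun_prop) ?_ hε
    filter_upwards [eventually_gt_atTop k] with n hn δ hδ
    refine (measureReal_abs_quadPartialSum_le_of_mem hξ c α β hn
      (abs_pos.1 (hm0.trans hk)) δ).trans ?_
    gcongr
  have h2 : Tendsto (fun m => 2 * √((1 / Real.pi) * (ε / m))) (𝓝[<] (maxAbs β))
      (𝓝 (2 * √((1 / Real.pi) * (ε / maxAbs β)))) := by
    have : ContinuousAt (fun m => 2 * √((1 / Real.pi) * (ε / m))) (maxAbs β) := by
      have := hβ.ne'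
      fun_prop (disch := assumption)
    exact this.tendsto.mono_left nhdsWithin_le_nhds
  exact ge_of_tendsto h2 (Filter.mem_of_superset (Ioo_mem_nhdsLT hβ) h1)

end

theorem memLp_two_quad_gaussianReal (a b : ℝ) :
    MemLp (fun x : ℝ => a * x + b * (x ^ 2 - 1)) 2 (gaussianReal 0 1) := by
  have h1 : MemLp (fun x : ℝ => x) 2 (gaussianReal 0 1) := memLp_id_gaussianReal 2
  have h4 : MemLp (fun x : ℝ => x) 4 (gaussianReal 0 1) := memLp_id_gaussianReal 4
  have h2 : MemLp (fun x : ℝ => x ^ 2) 2 (gaussianReal 0 1) := by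
    rw [memLp_two_iff_integrable_sq (by fun_prop)]
    have := h4.integrable_norm_pow (p := 4) (by norm_num)
    refine this.congr (ae_of_all _ fun x => ?_)
    simp only [Real.norm_eq_abs]
    rw [← pow_mul, (by decide : Even 4).pow_abs]
  exact (h1.const_mul a).add ((h2.sub (memLp_const 1)).const_mul b)

theorem integral_quad_gaussianReal (a b : ℝ) :
    ∫ x, (a * x + b * (x ^ 2 - 1)) ∂gaussianReal 0 1 = 0 := by
  have h1 : MemLp (fun x : ℝ => x) 2 (gaussianReal 0 1) := memLp_id_gaussianReal 2
  have hv := variance_fun_id_gaussianReal (μ := 0) (v := 1)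
  rw [variance_eq_sub h1, integral_id_gaussianReal] at hv
  have hsq : ∫ x : ℝ, x ^ 2 ∂gaussianReal 0 1 = 1 := by simpa using hv
  have h2 : Integrable (fun x : ℝ => x ^ 2 - 1) (gaussianReal 0 1) :=
    h1.integrable_sq.sub (integrable_const 1)
  rw [integral_add ((h1.integrable (by norm_num)).const_mul a) (h2.const_mul b),
    integral_const_mul,
    integral_const_mul, integral_sub h1.integrable_sq (integrable_const 1), hsq,
    integral_id_gaussianReal]
  simp

/-- A constant bounding the variance of `a * x + b * (x ^ 2 - 1)` by `a ^ 2 + 2 * b ^ 2`. -/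
noncomputable def quadVarConst : ℝ := 2 + ∫ x, (x ^ 2 - 1) ^ 2 ∂gaussianReal 0 1

theorem quadVarConst_pos : 0 < quadVarConst :=
  add_pos_of_pos_of_nonneg two_pos (integral_nonneg fun _ => sq_nonneg _)

theorem variance_quad_gaussianReal_le (a b : ℝ) :
    Var[fun x => a * x + b * (x ^ 2 - 1); gaussianReal 0 1] ≤
      quadVarConst * (a ^ 2 + 2 * b ^ 2) := by
  have h1 : MemLp (fun x : ℝ => x) 2 (gaussianReal 0 1) := memLp_id_gaussianReal 2
  have h2 : MemLp (fun x : ℝ => x ^ 2 - 1) 2 (gaussianReal 0 1) := by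
    simpa using memLp_two_quad_gaussianReal 0 1
  have hv := variance_fun_id_gaussianReal (μ := 0) (v := 1)
  rw [variance_eq_sub h1, integral_id_gaussianReal] at hv
  have hsq : ∫ x : ℝ, x ^ 2 ∂gaussianReal 0 1 = 1 := by simpa using hv
  have hM : 0 ≤ ∫ x : ℝ, (x ^ 2 - 1) ^ 2 ∂gaussianReal 0 1 := integral_nonneg fun _ => sq_nonneg _
  rw [variance_eq_sub (memLp_two_quad_gaussianReal a b), integral_quad_gaussianReal, quadVarConst]
  calc _ ≤ ∫ x : ℝ, (2 * a ^ 2 * x ^ 2 + 2 * b ^ 2 * (x ^ 2 - 1) ^ 2) ∂gaussianReal 0 1 := by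
        rw [zero_pow two_ne_zero, sub_zero]
        refine integral_mono (memLp_two_quad_gaussianReal a b).integrable_sq
          ((h1.integrable_sq.const_mul _).add (h2.integrable_sq.const_mul _)) fun x => ?_
        simp only [Pi.pow_apply]
        nlinarith [sq_nonneg (a * x - b * (x ^ 2 - 1))]
    _ = 2 * a ^ 2 + 2 * b ^ 2 * ∫ x : ℝ, (x ^ 2 - 1) ^ 2 ∂gaussianReal 0 1 := by
        rw [integral_add (h1.integrable_sq.const_mul _) (h2.integrable_sq.const_mul _),
          integral_const_mul, integral_const_mul, hsq, mul_one]
    _ ≤ _ := by nlinarith [sq_nonneg a, sq_nonneg b, mul_nonneg (sq_nonneg a) hM]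

section

variable {Ω : Type*} [MeasurableSpace Ω] {μ : Measure Ω} {ξ : ℕ → Ω → ℝ}

theorem IsStdGaussianSeq.memLp_term (hξ : IsStdGaussianSeq μ ξ) (a b : ℝ) (i : ℕ) :
    MemLp (fun ω => a * ξ i ω + b * (ξ i ω ^ 2 - 1)) 2 μ := by
  have h := memLp_two_quad_gaussianReal a b
  rw [← (hξ.law i).map_eq] at h
  exact h.comp_of_map (hξ.law i).aemeasurable

theorem memLp_quadPartialSum [IsProbabilityMeasure μ] (hξ : IsStdGaussianSeq μ ξ) (c : ℝ)
    (α β : ℕ → ℝ) (n : ℕ) : MemLp (quadPartialSum ξ c α β n) 2 μ :=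
  (memLp_const c).add (memLp_finsetSum _ fun i _ => hξ.memLp_term (α i) (β i) i)

theorem integral_quadPartialSum [IsProbabilityMeasure μ] (hξ : IsStdGaussianSeq μ ξ) (c : ℝ)
    (α β : ℕ → ℝ) (n : ℕ) : ∫ ω, quadPartialSum ξ c α β n ω ∂μ = c := by
  have hi : ∀ i, Integrable (fun ω => α i * ξ i ω + β i * (ξ i ω ^ 2 - 1)) μ := fun i =>
    (hξ.memLp_term (α i) (β i) i).integrable (by norm_num)
  have h0 : ∀ i, ∫ ω, (α i * ξ i ω + β i * (ξ i ω ^ 2 - 1)) ∂μ = 0 := fun i => by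
    rw [← integral_quad_gaussianReal (α i) (β i)]
    exact (hξ.law i).integral_comp (f := fun x : ℝ => α i * x + β i * (x ^ 2 - 1)) (by fun_prop)
  unfold quadPartialSum
  rw [integral_add (integrable_const c) (integrable_finsetSum _ fun i _ => hi i),
    integral_finsetSum _ fun i _ => hi i]
  simp [h0]

theorem variance_quadPartialSum_le [IsProbabilityMeasure μ] (hξ : IsStdGaussianSeq μ ξ) (c : ℝ)
    (α β : ℕ → ℝ) (n : ℕ) : Var[quadPartialSum ξ c α β n; μ] ≤
      quadVarConst * ∑ i ∈ Finset.range n, (α i ^ 2 + 2 * β i ^ 2) := by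
  have hind : iIndepFun (fun i ω => α i * ξ i ω + β i * (ξ i ω ^ 2 - 1)) μ :=
    hξ.indep.comp (fun i x => α i * x + β i * (x ^ 2 - 1)) fun i => by fun_prop
  have hmem := fun i => hξ.memLp_term (α i) (β i) i
  have h1 : quadPartialSum ξ c α β n = fun ω => c + (∑ i ∈ Finset.range n,
      fun ω => α i * ξ i ω + β i * (ξ i ω ^ 2 - 1)) ω := by
    ext ω
    simp [quadPartialSum]
  rw [h1, variance_const_add
      (memLp_finsetSum' _ fun i _ => hmem i).aestronglyMeasurable,
    IndepFun.variance_sum (fun i _ => hmem i) fun i _ j _ hij => hind.indepFun hij,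
    Finset.mul_sum]
  refine Finset.sum_le_sum fun i _ => ?_
  refine le_trans (le_of_eq ?_) (variance_quad_gaussianReal_le (α i) (β i))
  rw [← (hξ.law i).map_eq, variance_map (by fun_prop) (hξ.law i).aemeasurable]
  rfl

theorem measureReal_abs_le_le_variance [IsProbabilityMeasure μ] {X : Ω → ℝ} (hX : MemLp X 2 μ)
    {ε : ℝ} (hε : ε ≤ |μ[X]| / 2) (h0 : μ[X] ≠ 0) :
    μ.real {ω | |X ω| ≤ ε} ≤ 4 * Var[X; μ] / μ[X] ^ 2 := by
  have hp : 0 < |μ[X]| := abs_pos.2 h0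
  refine ENNReal.toReal_le_of_le_ofReal (by have := variance_nonneg X μ; positivity) ?_
  refine (measure_mono fun ω hω => ?_).trans
    ((meas_ge_le_variance_div_sq hX (half_pos hp)).trans_eq ?_)
  · have := abs_sub_abs_le_abs_sub (μ[X]) (X ω)
    rw [abs_sub_comm] at this
    simp only [Set.mem_ofPred_eq] at hω ⊢
    linarith
  · congr 1
    rw [div_pow, sq_abs]
    field_simp
    norm_num

theorem exists_measureReal_abs_quadPartialSum_le {c₁ : ℝ} (hc₁ : 0 < c₁) : ∃ C : ℝ, 1 ≤ C ∧
    ∀ (Ω : Type*) [MeasurableSpace Ω] (μ : Measure Ω) [IsProbabilityMeasure μ] (ξ : ℕ → Ω → ℝ),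
      IsStdGaussianSeq μ ξ → ∀ (c : ℝ) (α β : ℕ → ℝ) (n : ℕ),
        c₁ ≤ ∫ ω, quadPartialSum ξ c α β n ω ^ 2 ∂μ → ∀ ε : ℝ, 0 < ε →
          μ.real {ω | |quadPartialSum ξ c α β n ω| ≤ ε} ≤ C * ε ^ (1 / 3 : ℝ) := by
  set K := quadVarConst
  have hK : 0 < K := quadVarConst_pos
  set B := smoothingConst
  have hB : 0 ≤ B := smoothingConst_nonneg
  set s₀ : ℝ := √(c₁ / (2 * K)) with hs₀
  have hs₀p : 0 < s₀ := by positivity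
  set ε₀ : ℝ := min 1 (√(c₁ / 2) / 2) with hε₀
  have hε₀p : 0 < ε₀ := by positivity
  set C : ℝ := 1 + ε₀⁻¹ + B + B / s₀ ^ (1 / 2 : ℝ) + 8 * K / c₁ with hC
  have t1 : 0 ≤ ε₀⁻¹ := by positivity
  have t2 : 0 ≤ B / s₀ ^ (1 / 2 : ℝ) := by positivity
  have t3 : 0 ≤ 8 * K / c₁ := by positivity
  refine ⟨C, by linarith, fun Ω _ μ _ ξ hξ c α β n hq ε hε => ?_⟩
  have hp : 0 ≤ ε ^ (1 / 3 : ℝ) := by positivity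
  rcases le_or_gt ε₀ ε with hlarge | hsmall
  · refine measureReal_le_one.trans ?_
    have h1 : ε₀ ≤ ε ^ (1 / 3 : ℝ) := by
      calc ε₀ = ε₀ ^ (1 : ℝ) := (Real.rpow_one _).symm
        _ ≤ ε₀ ^ (1 / 3 : ℝ) :=
          Real.rpow_le_rpow_of_exponent_ge hε₀p (min_le_left _ _) (by norm_num)
        _ ≤ _ := by gcongr
    calc (1 : ℝ) = ε₀⁻¹ * ε₀ := by field_simp
      _ ≤ C * ε ^ (1 / 3 : ℝ) := by gcongr; linarith
  have hε1 : ε ≤ 1 := hsmall.le.trans (min_le_left _ _)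
  set S := ∑ i ∈ Finset.range n, (α i ^ 2 + 2 * β i ^ 2) with hS
  have hS0 : 0 ≤ S := Finset.sum_nonneg fun i _ => by positivity
  have hmem := memLp_quadPartialSum hξ c α β n
  have hmean := integral_quadPartialSum hξ c α β n
  have hvar := variance_quadPartialSum_le hξ c α β n
  have hsmooth : ∀ s', 0 < s' → s' ^ 2 ≤ S →
      μ.real {ω | |quadPartialSum ξ c α β n ω| ≤ ε} ≤ B * (ε / s') ^ (1 / 2 : ℝ) := by
    intro s' hs' hs'S
    have hSp : 0 < S := lt_of_lt_of_le (by positivity) hs'S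
    refine (measureReal_abs_quadPartialSum_le hξ c α β n (Real.sqrt_pos.2 hSp)
      (Real.sq_sqrt hS0) hε).trans ?_
    gcongr
    exact Real.le_sqrt_of_sq_le hs'S
  have hsecond : Var[quadPartialSum ξ c α β n; μ] =
      ∫ ω, quadPartialSum ξ c α β n ω ^ 2 ∂μ - c ^ 2 := by
    rw [variance_eq_sub hmem, hmean]
    rfl
  rcases le_or_gt (c ^ 2) (c₁ / 2) with hc | hc
  · have hsS : s₀ ^ 2 ≤ S := by
      rw [hs₀, Real.sq_sqrt (by positivity), div_le_iff₀ (by positivity)]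
      nlinarith
    calc _ ≤ B * (ε / s₀) ^ (1 / 2 : ℝ) := hsmooth s₀ hs₀p hsS
      _ = B / s₀ ^ (1 / 2 : ℝ) * ε ^ (1 / 2 : ℝ) := by
        rw [Real.div_rpow hε.le hs₀p.le]; ring
      _ ≤ C * ε ^ (1 / 3 : ℝ) := by
        gcongr ?_ * ?_
        · linarith
        · exact Real.rpow_le_rpow_of_exponent_ge hε hε1 (by norm_num)
  rcases le_or_gt S (ε ^ (1 / 3 : ℝ)) with hSε | hSε
  · have hc0 : c ≠ 0 := by
      rintro rfl
      norm_num at hc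
      linarith
    have hεc : ε ≤ |c| / 2 := by
      have h1 : √(c₁ / 2) ≤ |c| := Real.sqrt_le_iff.2 ⟨abs_nonneg _, by rw [sq_abs]; exact hc.le⟩
      have h2 := min_le_right 1 (√(c₁ / 2) / 2)
      linarith
    have h := measureReal_abs_le_le_variance hmem (ε := ε) (by rwa [hmean]) (by rwa [hmean])
    rw [hmean] at h
    refine h.trans ?_
    calc _ ≤ 4 * (K * S) / (c₁ / 2) := by gcongr
      _ = 8 * K / c₁ * S := by field_simp; ring
      _ ≤ C * ε ^ (1 / 3 : ℝ) := by
        gcongr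
        linarith
  · have h6 : (ε ^ (1 / 6 : ℝ)) ^ 2 ≤ S := by
      rw [← Real.rpow_natCast, ← Real.rpow_mul hε.le]
      norm_num at hSε ⊢
      exact hSε.le
    calc _ ≤ B * (ε / ε ^ (1 / 6 : ℝ)) ^ (1 / 2 : ℝ) := hsmooth _ (by positivity) h6
      _ = B * ε ^ (5 / 12 : ℝ) := by
        nth_rw 1 [← Real.rpow_one ε]
        rw [← Real.rpow_sub hε, ← Real.rpow_mul hε.le]
        norm_num
      _ ≤ C * ε ^ (1 / 3 : ℝ) := by
        gcongr ?_ * ?_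
        · linarith
        · exact Real.rpow_le_rpow_of_exponent_ge hε hε1 (by norm_num)

theorem HasQuadExpansion.eventually_le_integral_sq [IsProbabilityMeasure μ]
    (hξ : IsStdGaussianSeq μ ξ) {c : ℝ} {α β : ℕ → ℝ} {q : Ω → ℝ}
    (h : HasQuadExpansion μ ξ c α β q) {c₀ : ℝ} (hc₀ : 0 < c₀) (hq : c₀ ≤ ∫ ω, q ω ^ 2 ∂μ) :
    ∀ᶠ n in atTop, c₀ / 4 ≤ ∫ ω, quadPartialSum ξ c α β n ω ^ 2 ∂μ := by
  have hpos : (0 : ENNReal) < ENNReal.ofReal ((c₀ / 4) ^ (2⁻¹ : ℝ)) := by simp; positivity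
  filter_upwards [h.tendsto.eventually (gt_mem_nhds hpos)] with n hn
  have hm := memLp_quadPartialSum hξ c α β n
  have hd : MemLp (fun ω => quadPartialSum ξ c α β n ω - q ω) 2 μ := hm.sub h.memLp
  rw [hd.eLpNorm_eq_integral_rpow_norm (by simp) (by simp)] at hn
  have h2 := (ENNReal.ofReal_lt_ofReal_iff (by positivity)).1 hn
  simp only [ENNReal.toReal_ofNat, Real.rpow_ofNat, Real.norm_eq_abs, sq_abs] at h2
  have h1 := (Real.rpow_lt_rpow_iff (integral_nonneg fun _ => by positivity) (by positivity)
    (by norm_num)).1 h2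
  have h3 : ∫ ω, q ω ^ 2 ∂μ ≤ ∫ ω, (2 * quadPartialSum ξ c α β n ω ^ 2 +
      2 * (quadPartialSum ξ c α β n ω - q ω) ^ 2) ∂μ := by
    refine integral_mono h.memLp.integrable_sq
      ((hm.integrable_sq.const_mul _).add (hd.integrable_sq.const_mul _)) fun ω => ?_
    simp only
    nlinarith [sq_nonneg (2 * quadPartialSum ξ c α β n ω - q ω)]
  rw [integral_add (hm.integrable_sq.const_mul _) (hd.integrable_sq.const_mul _),
    integral_const_mul, integral_const_mul] at h3
  linarith

theorem exists_measureReal_abs_le_le_of_integral_sq {c₀ : ℝ} (hc₀ : 0 < c₀) : ∃ C : ℝ, 1 ≤ C ∧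
    ∀ (Ω : Type*) [MeasurableSpace Ω] (μ : Measure Ω) [IsProbabilityMeasure μ] (ξ : ℕ → Ω → ℝ),
      IsStdGaussianSeq μ ξ → ∀ q ∈ quadForms μ ξ, c₀ ≤ ∫ ω, q ω ^ 2 ∂μ →
        ∀ ε : ℝ, 0 ≤ ε → μ.real {ω | |q ω| ≤ ε} ≤ C * ε ^ (1 / 3 : ℝ) := by
  obtain ⟨C, hC, h⟩ := exists_measureReal_abs_quadPartialSum_le (c₁ := c₀ / 4) (by positivity)
  refine ⟨C, hC, fun Ω _ μ _ ξ hξ q ⟨c, α, β, hq⟩ hq0 ε hε => ?_⟩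
  refine measureReal_abs_le_le_of_tendstoInMeasure (hq.tendstoInMeasure hξ)
    (F := fun ε => C * ε ^ (1 / 3 : ℝ))
    (continuous_const.mul (Real.continuous_rpow_const (by norm_num))) ?_ hε
  filter_upwards [hq.eventually_le_integral_sq hξ hc₀ hq0] with n hn
  exact h Ω μ ξ hξ c α β n hn

end

theorem mainTheorem5 :
    (∀ c₀ : ℝ, 0 < c₀ → ∃ C : ℝ, 0 < C ∧
      ∀ (Ω : Type*) [MeasurableSpace Ω] (μ : Measure Ω) [IsProbabilityMeasure μ]
        (ξ : ℕ → Ω → ℝ), IsStdGaussianSeq μ ξ →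
        ∀ q ∈ quadForms μ ξ, c₀ ≤ |∫ ω, q ω ∂μ| →
          ∀ ε : ℝ, 0 ≤ ε → μ.real {ω | |q ω| ≤ ε} ≤ C * ε ^ (2 / 7 : ℝ)) ∧
    (∀ c₀ : ℝ, 0 < c₀ → ∃ C' : ℝ, 0 < C' ∧
      ∀ (Ω : Type*) [MeasurableSpace Ω] (μ : Measure Ω) [IsProbabilityMeasure μ]
        (ξ : ℕ → Ω → ℝ), IsStdGaussianSeq μ ξ →
        ∀ q ∈ quadForms μ ξ, c₀ ≤ ∫ ω, (q ω) ^ 2 ∂μ →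
          ∀ ε : ℝ, 0 ≤ ε → μ.real {ω | |q ω| ≤ ε} ≤ C' * ε ^ (1 / 3 : ℝ)) ∧
    (∀ (Ω : Type*) [MeasurableSpace Ω] (μ : Measure Ω) [IsProbabilityMeasure μ]
        (ξ : ℕ → Ω → ℝ), IsStdGaussianSeq μ ξ →
        ∀ (c : ℝ) (α β : ℕ → ℝ) (q : Ω → ℝ), HasQuadExpansion μ ξ c α β q → 0 < maxAbs β →
          ∀ ε : ℝ, 0 ≤ ε →
            μ.real {ω | |q ω| ≤ ε} ≤ 2 * Real.sqrt ((1 / Real.pi) * (ε / maxAbs β))) := by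
  refine ⟨fun c₀ hc₀ => ?_, fun c₀ hc₀ => ?_, ?_⟩
  · obtain ⟨C, hC, h⟩ := exists_measureReal_abs_le_le_of_integral_sq (c₀ := c₀ ^ 2) (by positivity)
    refine ⟨C, by linarith, fun Ω _ μ _ ξ hξ q hq hq0 ε hε => ?_⟩
    have hmem : MemLp q 2 μ := by
      obtain ⟨_, _, _, hq⟩ := hq
      exact hq.memLp
    have hq2 : c₀ ^ 2 ≤ ∫ ω, q ω ^ 2 ∂μ := by
      have hv := variance_nonneg q μ
      rw [variance_eq_sub hmem] at hv
      have hsq : c₀ ^ 2 ≤ (∫ ω, q ω ∂μ) ^ 2 := by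
        rw [← sq_abs (∫ ω, q ω ∂μ)]
        gcongr
      simp only [Pi.pow_apply] at hv
      linarith
    rcases le_or_gt ε 1 with h1 | h1
    · refine (h Ω μ ξ hξ q hq hq2 ε hε).trans ?_
      exact mul_le_mul_of_nonneg_left
        (Real.rpow_le_rpow_of_exponent_ge' hε h1 (by norm_num) (by norm_num)) (by linarith)
    · refine measureReal_le_one.trans ?_
      exact one_le_mul_of_one_le_of_one_le hC (Real.one_le_rpow h1.le (by norm_num))
  · obtain ⟨C, hC, h⟩ := exists_measureReal_abs_le_le_of_integral_sq hc₀
    exact ⟨C, by linarith, h⟩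
  · intro Ω _ μ _ ξ hξ c α β q hq hβ ε hε
    exact hq.measureReal_abs_le_le_sqrt hξ hβ hε
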